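/- Let $M:\mathbb{R}^N\to\mathbb{R}^{N\times N}$ satisfy $\|M(x)-M(y)\|\le L|x-y|$ for all $x,y\in\mathbb{R}^N$ (with $\|\cdot\|$ the operator norm and $L>0$), and let $g:\mathbb{R}^N\to\mathbb{R}$ be bounded with $|g(x)-g(y)|\le C|x-y|$ for all $x,y\in\mathbb{R}^N$, where $C>0$. Set $T=\frac{2}{LC}$ and consider the initial value problem $$u_t(x,t)+\tfrac12 M(x)\nabla u(x,t)\cdot\nabla u(x,t)=0\quad (x\in\mathbb{R}^N,\ t\in(0,T)),\qquad u(x,0)=g(x)\quad(x\in\mathbb{R}^N),\tag{1}$$ where $\nabla$ is the gradient in $x$. A bounded upper semicontinuous function $v:\mathbb{R}^N\times[0,T)\to\mathbb{R}$ is a viscosity subsolution of (1) if $v(x,0)\le g(x)$ for all $x\in\mathbb{R}^N$ and, for every $\varphi\in C^1(\mathbb{R}^N\times(0,T))$, whenever $v-\varphi$ has a local maximum at a point $(y_0,t_0)\in\mathbb{R}^N\times(0,T)$, $$\varphi_t(y_0,t_0)+\tfrac12M(y_0)\nabla\varphi(y_0,t_0)\cdot\nabla\varphi(y_0,t_0)\le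 0.$$ A bounded lower semicontinuous $v:\mathbb{R}^N\times[0,T)\to\mathbb{R}$ is a viscosity supersolution of (1) if $v(x,0)\ge g(x)$ for all $x$ and, for every such $\varphi$, the same expression is $\ge0$ whenever $v-\varphi$ has a local minimum at $(y_0,t_0)\in\mathbb{R}^N\times(0,T)$. A viscosity solution is a function that is both. Then: 1. If $u$ is a viscosity subsolution and $v$ a viscosity supersolution of (1), then $u\le v$ on $\mathbb{R}^N\times[0,T)$. In particular, (1) has at most one viscosity solution. 2. If $u$ is a viscosity solution of (1), then for every $\tau\in(0,T)$ there is $L_\tau>0$ such that $$|u(x,t)-u(y,t)|\le L_\tau|x-y|\quad\text{for all }x,y\in\mathbb{R}^N,\ t\in[0,\tau],$$ and for every $\tau\in(0,T)$ and $R>0$ there is $L_{\tau,R}>0$ such that $$|u(x,t)-u(x,s)|\le L_{\tau,R}|t-s|\quad\text{for all }|x|<R,\ t,s\in[0,\tau].$$ 3. If, in addition, $M$ is bounded and $u$ is a viscosity solution of (1), then for every $\tau\in(0,T)$ there is $L_\tau>0$ such that $$|u(x,t)-u(y,s)|\le L_\tau\bigl(|x-y|+|t-s|\bigr)\quad\text{for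 all }x,y\in\mathbb{R}^N,\ t,s\in[0,\tau].$$ -/

import Mathlib

open Set Topology

noncomputable section

/-- Operator norm of a real `N × N` matrix, acting on Euclidean space. -/
def matOpNorm {N : ℕ} (A : Matrix (Fin N) (Fin N) ℝ) : ℝ :=
  ‖Matrix.toEuclideanCLM (𝕜 := ℝ) A‖

/-- The value `φ_t + (1/2) M(y) ∇φ · ∇φ` at the point `(y, t)`; the gradient is taken
with respect to the space variable. -/
def hjOperator {N : ℕ} (M : EuclideanSpace ℝ (Fin N) → Matrix (Fin N) (Fin N) ℝ)
    (φ : EuclideanSpace ℝ (Fin N) → ℝ → ℝ) (y : EuclideanSpace ℝ (Fin N)) (t : ℝ) : ℝ :=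
  deriv (fun s => φ y s) t +
    (1 / 2) * inner ℝ
      (Matrix.toEuclideanCLM (𝕜 := ℝ) (M y) (gradient (fun x => φ x t) y))
      (gradient (fun x => φ x t) y)

/-- Boundedness of `v` on `ℝ^N × [0,T)`. -/
def BoundedOnStrip {N : ℕ} (T : ℝ) (v : EuclideanSpace ℝ (Fin N) → ℝ → ℝ) : Prop :=
  ∃ B : ℝ, ∀ x, ∀ t ∈ Ico 0 T, |v x t| ≤ B

/-- `v : ℝ^N × [0,T) → ℝ` is a viscosity subsolution of
`u_t + (1/2) M(x) ∇u · ∇u = 0`, `u(x,0) = g(x)`. Only the values of `v` on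
`ℝ^N × [0,T)` matter. -/
structure IsViscositySubsolution {N : ℕ}
    (M : EuclideanSpace ℝ (Fin N) → Matrix (Fin N) (Fin N) ℝ)
    (g : EuclideanSpace ℝ (Fin N) → ℝ) (T : ℝ)
    (v : EuclideanSpace ℝ (Fin N) → ℝ → ℝ) : Prop where
  bounded : BoundedOnStrip T v
  usc : UpperSemicontinuousOn (Function.uncurry v) (univ ×ˢ Ico 0 T)
  initial : ∀ x, v x 0 ≤ g x
  test : ∀ φ : EuclideanSpace ℝ (Fin N) → ℝ → ℝ,
    ContDiffOn ℝ 1 (Function.uncurry φ) (univ ×ˢ Ioo 0 T) →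
    ∀ y₀, ∀ t₀ ∈ Ioo 0 T,
      IsLocalMax (fun p : EuclideanSpace ℝ (Fin N) × ℝ => v p.1 p.2 - φ p.1 p.2) (y₀, t₀) →
      hjOperator M φ y₀ t₀ ≤ 0

/-- `v : ℝ^N × [0,T) → ℝ` is a viscosity supersolution of
`u_t + (1/2) M(x) ∇u · ∇u = 0`, `u(x,0) = g(x)`. Only the values of `v` on
`ℝ^N × [0,T)` matter. -/
structure IsViscositySupersolution {N : ℕ}
    (M : EuclideanSpace ℝ (Fin N) → Matrix (Fin N) (Fin N) ℝ)
    (g : EuclideanSpace ℝ (Fin N) → ℝ) (T : ℝ)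
    (v : EuclideanSpace ℝ (Fin N) → ℝ → ℝ) : Prop where
  bounded : BoundedOnStrip T v
  lsc : LowerSemicontinuousOn (Function.uncurry v) (univ ×ˢ Ico 0 T)
  initial : ∀ x, g x ≤ v x 0
  test : ∀ φ : EuclideanSpace ℝ (Fin N) → ℝ → ℝ,
    ContDiffOn ℝ 1 (Function.uncurry φ) (univ ×ˢ Ioo 0 T) →
    ∀ y₀, ∀ t₀ ∈ Ioo 0 T,
      IsLocalMin (fun p : EuclideanSpace ℝ (Fin N) × ℝ => v p.1 p.2 - φ p.1 p.2) (y₀, t₀) →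
      0 ≤ hjOperator M φ y₀ t₀

/-- A viscosity solution is both a viscosity subsolution and a viscosity supersolution. -/
def IsViscositySolution {N : ℕ}
    (M : EuclideanSpace ℝ (Fin N) → Matrix (Fin N) (Fin N) ℝ)
    (g : EuclideanSpace ℝ (Fin N) → ℝ) (T : ℝ)
    (v : EuclideanSpace ℝ (Fin N) → ℝ → ℝ) : Prop :=
  IsViscositySubsolution M g T v ∧ IsViscositySupersolution M g T v

end

/-!
The function `K(t) = 2 / (L (T - t))` solves `K' = (L / 2) K²`, equals `C` at `t = 0` and blows up
exactly at `T = 2 / (L C)`. Because `M` is `L`-Lipschitz, `w(x, y, t) = K(t) |x - y|` is a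
supersolution of the doubled equation: with `p = K (x - y) / |x - y|`,
`w_t = (L / 2) K² |x - y| ≥ (1/2) (M(y) - M(x)) p · p`. Hence every subsolution `u` and supersolution
`v` satisfy `u(x, t) - v(y, t) ≤ K(t) |x - y|`, since this holds at `t = 0`
(`IsViscositySubsolution.sub_le_lipBound_mul_norm`). Taking `y = x` gives comparison and uniqueness,
and taking `v = u` gives the Lipschitz bound in space.

The estimate is proved by doubling the time variable as well. The norm is replaced by
`√(|x - y|² + ε²)`, for which the supersolution inequality persists. As `M` grows at most linearly,
the coercive penalty `δ log (1 + |x|²)` changes the Hamiltonian only by `O(δ)` uniformly in `x`, and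
terms `σ / (T - t)`, `σ / (T - s)` keep the maximum away from time `T` and supply the strict
inequality that is contradicted in `not_isMax_doubling`.

For the regularity in time, `u` is compared near `x₀` with
`a |x - x₀|² + A (t - s)` plus small errors. Since `u` is `K`-Lipschitz in space, the maximum of the
difference lies within `K / a` of `x₀` and the gradient of the test function is at most `2 K` there,
so the equation allows any slope `A > 2 m K²`, where `m` bounds `|M|` near `x₀`; then `a → ∞`
(`IsViscositySubsolution.time_increment_le`). The bound from below follows because `-u` solves the
problem for `-M` and `-g`.
-/

/-! ### Gradients of radial functions -/

section SmoothNorm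

variable {E : Type*} [NormedAddCommGroup E]

/-- The smooth approximation `√(|z|² + ε²)` of the norm. -/
noncomputable def smoothNorm (ε : ℝ) (z : E) : ℝ := Real.sqrt (‖z‖ ^ 2 + ε ^ 2)

theorem norm_le_smoothNorm (ε : ℝ) (z : E) : ‖z‖ ≤ smoothNorm ε z :=
  Real.le_sqrt_of_sq_le (by nlinarith [sq_nonneg ε])

theorem smoothNorm_pos {ε : ℝ} (hε : 0 < ε) (z : E) : 0 < smoothNorm ε z :=
  Real.sqrt_pos.2 (by positivity)

theorem smoothNorm_le_norm_add {ε : ℝ} (hε : 0 ≤ ε) (z : E) : smoothNorm ε z ≤ ‖z‖ + ε :=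
  Real.sqrt_le_iff.2 ⟨by positivity, by nlinarith [mul_nonneg (norm_nonneg z) hε]⟩

theorem smoothNorm_sub_comm (ε : ℝ) (x y : E) : smoothNorm ε (x - y) = smoothNorm ε (y - x) := by
  simp only [smoothNorm, norm_sub_rev]

end SmoothNorm

section Gradients

variable {E : Type*} [NormedAddCommGroup E] [InnerProductSpace ℝ E]

theorem HasGradientAt.add_real [CompleteSpace E] {f g : E → ℝ} {p q z : E}
    (hf : HasGradientAt f p z) (hg : HasGradientAt g q z) :
    HasGradientAt (fun x => f x + g x) (p + q) z := by
  rw [hasGradientAt_iff_hasFDerivAt] at *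
  rw [map_add]
  exact hf.add hg

theorem HasDerivAt.comp_hasGradientAt_real [CompleteSpace E] {h : ℝ → ℝ} {h' : ℝ} {f : E → ℝ}
    {p z : E} (hh : HasDerivAt h h' (f z)) (hf : HasGradientAt f p z) :
    HasGradientAt (fun x => h (f x)) (h' • p) z := by
  rw [hasGradientAt_iff_hasFDerivAt] at *
  have := hh.comp_hasFDerivAt z hf
  rw [map_smulₛₗ]
  exact this

theorem hasGradientAt_norm_sub_sq [CompleteSpace E] (y z : E) :
    HasGradientAt (fun x => ‖x - y‖ ^ 2) ((2 : ℝ) • (z - y)) z := by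
  rw [hasGradientAt_iff_hasFDerivAt]
  have h : HasFDerivAt (fun x : E => ‖x - y‖ ^ 2) _ z :=
    ((hasFDerivAt_id (𝕜 := ℝ) z).sub_const y).norm_sq
  refine h.congr_fderiv ?_
  ext v
  simp

theorem contDiff_smoothNorm {ε : ℝ} (hε : 0 < ε) :
    ContDiff ℝ 1 (smoothNorm ε : E → ℝ) :=
  ((contDiff_norm_sq ℝ).add contDiff_const).sqrt fun z => by positivity

theorem hasGradientAt_smoothNorm_sub [CompleteSpace E] {ε : ℝ} (hε : 0 < ε) (y z : E) :
    HasGradientAt (fun x => smoothNorm ε (x - y)) ((smoothNorm ε (z - y))⁻¹ • (z - y)) z := by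
  have h1 : HasDerivAt (fun r : ℝ => Real.sqrt (r + ε ^ 2))
      (1 / (2 * Real.sqrt (‖z - y‖ ^ 2 + ε ^ 2))) (‖z - y‖ ^ 2) :=
    ((hasDerivAt_id _).add_const _).sqrt (by positivity)
  have h2 := h1.comp_hasGradientAt_real (f := fun x => ‖x - y‖ ^ 2) (hasGradientAt_norm_sub_sq y z)
  convert h2 using 1
  · rfl
  rw [smul_smul, smoothNorm]
  congr 1
  field_simp

theorem hasGradientAt_log_one_add_norm_sq [CompleteSpace E] (z : E) :
    HasGradientAt (fun x : E => Real.log (1 + ‖x‖ ^ 2)) ((2 / (1 + ‖z‖ ^ 2)) • z) z := by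
  have h1 : HasDerivAt (fun r : ℝ => Real.log (1 + r)) (1 / (1 + ‖z - 0‖ ^ 2)) (‖z - 0‖ ^ 2) :=
    ((hasDerivAt_id _).const_add _).log (by positivity)
  have h2 := h1.comp_hasGradientAt_real (f := fun x => ‖x - 0‖ ^ 2) (hasGradientAt_norm_sub_sq 0 z)
  simp only [sub_zero, smul_smul] at h2
  convert h2 using 2
  ring

theorem contDiff_log_one_add_norm_sq :
    ContDiff ℝ 1 (fun x : E => Real.log (1 + ‖x‖ ^ 2)) :=
  (contDiff_const.add (contDiff_norm_sq ℝ)).log fun z => by positivity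

end Gradients

/-! ### The Hamiltonian -/

section Hamiltonian

variable {N : ℕ}

/-- The quadratic Hamiltonian `(1/2) A p · p`. -/
noncomputable def hamiltonian (A : Matrix (Fin N) (Fin N) ℝ) (p : EuclideanSpace ℝ (Fin N)) : ℝ :=
  (1 / 2) * inner ℝ (Matrix.toEuclideanCLM (𝕜 := ℝ) A p) p

theorem hjOperator_eq_add_hamiltonian
    (M : EuclideanSpace ℝ (Fin N) → Matrix (Fin N) (Fin N) ℝ)
    {φ : EuclideanSpace ℝ (Fin N) → ℝ → ℝ} {y p : EuclideanSpace ℝ (Fin N)} {t d : ℝ}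
    (hd : HasDerivAt (fun s => φ y s) d t) (hp : HasGradientAt (fun x => φ x t) p y) :
    hjOperator M φ y t = d + hamiltonian (M y) p := by
  rw [hjOperator, hamiltonian, hd.deriv, hp.gradient]

theorem matOpNorm_nonneg (A : Matrix (Fin N) (Fin N) ℝ) : 0 ≤ matOpNorm A := norm_nonneg _

theorem matOpNorm_neg (A : Matrix (Fin N) (Fin N) ℝ) : matOpNorm (-A) = matOpNorm A := by
  simp [matOpNorm]

theorem matOpNorm_le_add_of_lipschitz {M : EuclideanSpace ℝ (Fin N) → Matrix (Fin N) (Fin N) ℝ}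
    {L : ℝ} (hM : ∀ x y, matOpNorm (M x - M y) ≤ L * ‖x - y‖) (x y : EuclideanSpace ℝ (Fin N)) :
    matOpNorm (M x) ≤ matOpNorm (M y) + L * ‖x - y‖ := by
  have h : matOpNorm (M x) - matOpNorm (M y) ≤ matOpNorm (M x - M y) := by
    simp only [matOpNorm, map_sub]
    exact norm_sub_norm_le _ _
  linarith [hM x y]

theorem abs_inner_toEuclideanCLM_le (A : Matrix (Fin N) (Fin N) ℝ)
    (p q : EuclideanSpace ℝ (Fin N)) :
    |inner ℝ (Matrix.toEuclideanCLM (𝕜 := ℝ) A p) q| ≤ matOpNorm A * ‖p‖ * ‖q‖ :=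
  (abs_real_inner_le_norm _ _).trans <|
    mul_le_mul_of_nonneg_right (ContinuousLinearMap.le_opNorm _ _) (norm_nonneg _)

theorem abs_hamiltonian_le (A : Matrix (Fin N) (Fin N) ℝ) (p : EuclideanSpace ℝ (Fin N)) :
    |hamiltonian A p| ≤ (1 / 2) * (matOpNorm A * ‖p‖ ^ 2) := by
  rw [hamiltonian, abs_mul, abs_of_pos (by norm_num : (0 : ℝ) < 1 / 2), sq, ← mul_assoc]
  have := abs_inner_toEuclideanCLM_le A p p
  linarith

theorem hamiltonian_sub_le (A B : Matrix (Fin N) (Fin N) ℝ) (p q : EuclideanSpace ℝ (Fin N)) :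
    hamiltonian B p - hamiltonian A (p + q) ≤
      (1 / 2) * (matOpNorm (A - B) * ‖p‖ ^ 2) +
        (1 / 2) * (matOpNorm A * ‖q‖ * (2 * ‖p‖ + ‖q‖)) := by
  have h1 := (abs_le.1 (abs_inner_toEuclideanCLM_le (A - B) p p)).1
  have h2 := (abs_le.1 (abs_inner_toEuclideanCLM_le A p q)).1
  have h3 := (abs_le.1 (abs_inner_toEuclideanCLM_le A q p)).1
  have h4 := (abs_le.1 (abs_inner_toEuclideanCLM_le A q q)).1
  simp only [map_sub, sub_apply, inner_sub_left] at h1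
  simp only [hamiltonian, map_add, inner_add_left, inner_add_right]
  nlinarith

end Hamiltonian

/-! ### Maxima of penalised functions -/

/-- If an upper semicontinuous `F` is nonpositive at the points of the closed set `D` where the
penalty `d` vanishes, then subtracting a large multiple of `d` pushes the maximum off `D`. -/
theorem exists_isMaxOn_sub_penalty_notMem {X : Type*} [TopologicalSpace X] {S D : Set X}
    (hS : IsCompact S) (hD : IsClosed D) {F d : X → ℝ} {b : ℝ}
    (hF : UpperSemicontinuousOn F S) (hd : Continuous d) (hd0 : ∀ x, 0 ≤ d x)
    (hb : ∀ x ∈ S, F x ≤ b) (hFD : ∀ x ∈ S ∩ D, d x = 0 → F x ≤ 0)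
    {x₀ : X} (hx₀ : x₀ ∈ S) (hdx₀ : d x₀ = 0) (hFx₀ : 0 < F x₀) :
    ∃ κ : ℝ, 0 ≤ κ ∧ ∃ x ∈ S, x ∉ D ∧ 0 < F x - κ * d x ∧
      ∀ y ∈ S, F y - κ * d y ≤ F x - κ * d x := by
  have hZ : IsCompact ((S ∩ F ⁻¹' Ici (F x₀)) ∩ D) :=
    (hF.isCompact_inter_preimage_Ici hS _).inter_right hD
  have hb0 : 0 < b := hFx₀.trans_le (hb _ hx₀)
  -- `d` is bounded below by some `m > 0` on the part of `D` where `F` is at least `F x₀`.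
  obtain ⟨m, hm, hmZ⟩ : ∃ m : ℝ, 0 < m ∧ ∀ x ∈ (S ∩ F ⁻¹' Ici (F x₀)) ∩ D, m ≤ d x := by
    rcases ((S ∩ F ⁻¹' Ici (F x₀)) ∩ D).eq_empty_or_nonempty with h | h
    · exact ⟨1, one_pos, by simp [h]⟩
    · obtain ⟨z, hz, hzm⟩ := hZ.exists_isMinOn h hd.continuousOn
      refine ⟨d z, (hd0 z).lt_of_ne fun h0 => ?_, fun x hx => hzm hx⟩
      have h1 := hFD z ⟨hz.1.1, hz.2⟩ h0.symm
      have h2 : F x₀ ≤ F z := hz.1.2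
      linarith
  have hG : UpperSemicontinuousOn (fun x => F x + -(b / m * d x)) S :=
    hF.add (ContinuousOn.upperSemicontinuousOn
      (continuous_const.mul hd).neg.continuousOn)
  obtain ⟨x, hxS, hx⟩ := hG.exists_isMaxOn ⟨x₀, hx₀⟩ hS
  have hx' : ∀ y ∈ S, F y - b / m * d y ≤ F x - b / m * d x := fun y hy => by
    have : F y + -(b / m * d y) ≤ F x + -(b / m * d x) := hx hy
    linarith
  have hκ : 0 < b / m := div_pos hb0 hm
  have h1 : F x₀ ≤ F x - b / m * d x := by simpa [hdx₀] using hx' x₀ hx₀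
  refine ⟨b / m, hκ.le, x, hxS, fun hxD => ?_, by linarith, hx'⟩
  have h2 : F x₀ ≤ F x := by nlinarith [mul_nonneg hκ.le (hd0 x)]
  have h3 := hmZ x ⟨⟨hxS, h2⟩, hxD⟩
  have h4 : b ≤ b / m * d x := by
    calc b = b / m * m := by field_simp
      _ ≤ _ := by gcongr
  linarith [hb x hxS]

/-! ### Doubling of variables -/

section Doubling

variable {N : ℕ} {M : EuclideanSpace ℝ (Fin N) → Matrix (Fin N) (Fin N) ℝ}
  {g : EuclideanSpace ℝ (Fin N) → ℝ} {L T : ℝ} {u v : EuclideanSpace ℝ (Fin N) → ℝ → ℝ}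

/-- The solution `K(t) = 2 / (L (T - t))` of `K' = (L / 2) K²` that blows up at time `T`. -/
noncomputable def lipBound (L T t : ℝ) : ℝ := 2 / (L * (T - t))

theorem lipBound_pos {L T t : ℝ} (hL : 0 < L) (ht : t < T) : 0 < lipBound L T t :=
  div_pos two_pos (mul_pos hL (sub_pos.2 ht))

theorem lipBound_mono {L T s t : ℝ} (hL : 0 < L) (hst : s ≤ t) (ht : t < T) :
    lipBound L T s ≤ lipBound L T t := by
  have := sub_pos.2 ht
  unfold lipBound
  gcongr

theorem hasDerivAt_lipBound {L T t : ℝ} (hL : 0 < L) (ht : t < T) :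
    HasDerivAt (lipBound L T) (L / 2 * lipBound L T t ^ 2) t := by
  have h0 : T - t ≠ 0 := (sub_pos.2 ht).ne'
  have h := (((hasDerivAt_id t).const_sub T).const_mul L).inv (mul_ne_zero hL.ne' h0)
  have h' := h.const_mul 2
  refine h'.congr_deriv ?_
  simp only [lipBound, id]
  field_simp

theorem hasDerivAt_const_div_sub {σ T t : ℝ} (ht : t < T) :
    HasDerivAt (fun r => σ / (T - r)) (σ / (T - t) ^ 2) t := by
  have h0 : T - t ≠ 0 := (sub_pos.2 ht).ne'
  have h := (((hasDerivAt_id t).const_sub T).inv h0).const_mul σ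
  refine h.congr_deriv ?_
  simp only [id]
  field_simp

theorem hasDerivAt_const_mul_sub_sq (κ s t : ℝ) :
    HasDerivAt (fun r => κ * (r - s) ^ 2) (2 * κ * (t - s)) t := by
  have h := (((hasDerivAt_id t).sub_const s).pow 2).const_mul κ
  refine h.congr_deriv ?_
  simp
  ring

/-- The part of the penalty in the doubling argument other than `κ (t - s)²`. The term in
`K(t)` is a smooth supersolution of the doubled equation, the logarithm confines `x` and the last two terms confine the times below `T`. -/
noncomputable def doublingPenalty (L T ε δ σ : ℝ)
    (q : (EuclideanSpace ℝ (Fin N) × ℝ) × (EuclideanSpace ℝ (Fin N) × ℝ)) : ℝ :=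
  lipBound L T q.1.2 * smoothNorm ε (q.1.1 - q.2.1) + δ * Real.log (1 + ‖q.1.1‖ ^ 2) +
    (σ / (T - q.1.2) + σ / (T - q.2.2))

/-- `u(x,t) - v(y,s) - κ (t - s)²` minus the penalty cannot have an interior maximum when `δ` is
small compared with `σ`: subtracting the two viscosity inequalities leaves
`σ / (T - t)² + σ / (T - s)²` against an error of order `δ`. -/
theorem not_isMax_doubling (hL : 0 < L)
    (hM : ∀ x y, matOpNorm (M x - M y) ≤ L * ‖x - y‖)
    (hu : IsViscositySubsolution M g T u) (hv : IsViscositySupersolution M g T v)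
    {ε δ σ κ P : ℝ} (hε : 0 < ε) (hδ : 0 < δ) (hδ1 : δ ≤ 1) (hσ : 0 < σ)
    {x y : EuclideanSpace ℝ (Fin N)} {t s : ℝ} (ht : t ∈ Ioo 0 T) (hs : s ∈ Ioo 0 T)
    (hP : lipBound L T t ≤ P)
    (hδσ : 1 / 2 * ((matOpNorm (M 0) + 2 * L) * δ * (2 * P + 1)) < σ / T ^ 2)
    (hmax : ∀ x' y', ∀ t' ∈ Ioo 0 T, ∀ s' ∈ Ioo 0 T,
      u x' t' - v y' s' - doublingPenalty L T ε δ σ ((x', t'), (y', s')) - κ * (t' - s') ^ 2 ≤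
      u x t - v y s - doublingPenalty L T ε δ σ ((x, t), (y, s)) - κ * (t - s) ^ 2) : False := by
  have hT : 0 < T := ht.1.trans ht.2
  set K := lipBound L T t with hK
  have hK0 : 0 < K := lipBound_pos hL ht.2
  set ψ := smoothNorm ε (x - y) with hψ
  have hψ0 : 0 < ψ := smoothNorm_pos hε _
  set p : EuclideanSpace ℝ (Fin N) := K • ψ⁻¹ • (x - y) with hp
  set q : EuclideanSpace ℝ (Fin N) := δ • (2 / (1 + ‖x‖ ^ 2)) • x with hq
  have hIoo : ∀ r ∈ Ioo 0 T, ∀ z : EuclideanSpace ℝ (Fin N),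
      ∀ᶠ w : EuclideanSpace ℝ (Fin N) × ℝ in 𝓝 (z, r), w.2 ∈ Ioo 0 T := fun r hr z =>
    continuous_snd.continuousAt.eventually_mem (Ioo_mem_nhds hr.1 hr.2)
  -- The subsolution inequality at `(x, t)`.
  have h1 : (L / 2 * K ^ 2 * ψ + (σ / (T - t) ^ 2 + 2 * κ * (t - s))) +
      hamiltonian (M x) (p + q) ≤ 0 := by
    rw [← hjOperator_eq_add_hamiltonian M (φ := fun z r =>
      (lipBound L T r * smoothNorm ε (z - y) + δ * Real.log (1 + ‖z‖ ^ 2)) +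
        (σ / (T - r) + κ * (r - s) ^ 2))]
    · refine hu.test _ ?_ x t ht ?_
      · have hne : ∀ w ∈ (univ : Set (EuclideanSpace ℝ (Fin N))) ×ˢ Ioo 0 T, T - w.2 ≠ 0 :=
          fun w hw => (sub_pos.2 hw.2.2).ne'
        have hs1 : ContDiff ℝ 1 (fun w : EuclideanSpace ℝ (Fin N) × ℝ =>
          smoothNorm ε (w.1 - y)) := (contDiff_smoothNorm hε).comp (contDiff_fst.sub contDiff_const)
        have hs2 : ContDiff ℝ 1 (fun w : EuclideanSpace ℝ (Fin N) × ℝ =>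
          Real.log (1 + ‖w.1‖ ^ 2)) := contDiff_log_one_add_norm_sq.comp contDiff_fst
        have hs3 : ContDiff ℝ 1 (fun w : EuclideanSpace ℝ (Fin N) × ℝ => T - w.2) :=
          contDiff_const.sub contDiff_snd
        have hs4 : ContDiff ℝ 1 (fun w : EuclideanSpace ℝ (Fin N) × ℝ => κ * (w.2 - s) ^ 2) :=
          contDiff_const.mul ((contDiff_snd.sub contDiff_const).pow 2)
        refine ((((contDiffOn_const.div (contDiff_const.mul hs3).contDiffOn fun w hw =>
          mul_ne_zero hL.ne' (hne w hw)).mul hs1.contDiffOn).add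
          (contDiff_const.mul hs2).contDiffOn).add
          ((contDiffOn_const.div hs3.contDiffOn hne).add hs4.contDiffOn))
      · filter_upwards [hIoo t ht x] with w hw
        have := hmax w.1 y w.2 hw s hs
        simp only [doublingPenalty] at this
        linarith
    · exact (((hasDerivAt_lipBound hL ht.2).mul_const _).add_const _).add
        ((hasDerivAt_const_div_sub ht.2).add (hasDerivAt_const_mul_sub_sq κ s t))
    · have e1 := ((hasDerivAt_id _).const_mul K).comp_hasGradientAt_real
        (hasGradientAt_smoothNorm_sub hε y x)
      have e2 := ((hasDerivAt_id _).const_mul δ).comp_hasGradientAt_real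
        (hasGradientAt_log_one_add_norm_sq x)
      have e3 := (e1.add_real e2).add_real (hasGradientAt_const x (σ / (T - t) + κ * (t - s) ^ 2))
      simpa only [mul_one, add_zero, id] using e3
  -- The supersolution inequality at `(y, s)`.
  have h2 : 0 ≤ -(σ / (T - s) ^ 2 + 2 * κ * (s - t)) + hamiltonian (M y) p := by
    rw [← hjOperator_eq_add_hamiltonian M (φ := fun z r =>
      -K * smoothNorm ε (z - x) + -(σ / (T - r) + κ * (r - t) ^ 2))]
    · refine hv.test _ ?_ y s hs ?_
      · have hne : ∀ w ∈ (univ : Set (EuclideanSpace ℝ (Fin N))) ×ˢ Ioo 0 T, T - w.2 ≠ 0 :=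
          fun w hw => (sub_pos.2 hw.2.2).ne'
        have hs1 : ContDiff ℝ 1 (fun w : EuclideanSpace ℝ (Fin N) × ℝ =>
          smoothNorm ε (w.1 - x)) := (contDiff_smoothNorm hε).comp (contDiff_fst.sub contDiff_const)
        have hs3 : ContDiff ℝ 1 (fun w : EuclideanSpace ℝ (Fin N) × ℝ => T - w.2) :=
          contDiff_const.sub contDiff_snd
        have hs4 : ContDiff ℝ 1 (fun w : EuclideanSpace ℝ (Fin N) × ℝ => κ * (w.2 - t) ^ 2) :=
          contDiff_const.mul ((contDiff_snd.sub contDiff_const).pow 2)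
        exact ((contDiff_const.mul hs1).contDiffOn).add
          ((contDiffOn_const.div hs3.contDiffOn hne).add hs4.contDiffOn).neg
      · filter_upwards [hIoo s hs y] with w hw
        have := hmax x w.1 t ht w.2 hw
        simp only [doublingPenalty] at this
        rw [smoothNorm_sub_comm ε w.1 x, smoothNorm_sub_comm ε y x]
        linarith
    · exact ((hasDerivAt_const_div_sub hs.2).add
        (hasDerivAt_const_mul_sub_sq κ t s)).neg.const_add _
    · have e1 := ((hasDerivAt_id _).const_mul (-K)).comp_hasGradientAt_real
        (hasGradientAt_smoothNorm_sub hε x y)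
      have e3 := e1.add_real (hasGradientAt_const y (-(σ / (T - s) + κ * (s - t) ^ 2)))
      simp only [mul_one, add_zero, id] at e3
      convert e3 using 1
      rw [hp, hψ, smoothNorm_sub_comm ε y x, ← neg_sub y x, smul_neg, smul_neg, neg_smul]
  have h3 := hamiltonian_sub_le (M x) (M y) p q
  have hr : ‖x - y‖ ≤ ψ := norm_le_smoothNorm _ _
  have hpn : ‖p‖ = K * (‖x - y‖ / ψ) := by
    rw [hp, norm_smul, norm_smul, Real.norm_of_nonneg hK0.le,
      Real.norm_of_nonneg (inv_pos.2 hψ0).le, inv_mul_eq_div]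
  have hpK : ‖p‖ ≤ K := by
    rw [hpn]
    exact mul_le_of_le_one_right hK0.le ((div_le_one hψ0).2 hr)
  -- The choice of `K` absorbs the oscillation of `M`.
  have h4 : matOpNorm (M x - M y) * ‖p‖ ^ 2 ≤ L * K ^ 2 * ψ := by
    calc matOpNorm (M x - M y) * ‖p‖ ^ 2 ≤ (L * ψ) * K ^ 2 := by
          have := (hM x y).trans (mul_le_mul_of_nonneg_left hr hL.le)
          gcongr
      _ = _ := by ring
  have hqn : ‖q‖ = δ * (2 * ‖x‖ / (1 + ‖x‖ ^ 2)) := by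
    rw [hq, norm_smul, norm_smul, Real.norm_of_nonneg hδ.le,
      Real.norm_of_nonneg (by positivity)]
    ring
  have hA := matOpNorm_nonneg (M 0)
  have hq1 : ‖q‖ ≤ δ := by
    rw [hqn]
    refine mul_le_of_le_one_right hδ.le ((div_le_one (by positivity)).2 ?_)
    nlinarith [sq_nonneg (‖x‖ - 1)]
  have hq2 : ‖x‖ * ‖q‖ ≤ 2 * δ := by
    have : ‖x‖ * ‖q‖ = δ * (2 * ‖x‖ ^ 2 / (1 + ‖x‖ ^ 2)) := by rw [hqn]; ring
    rw [this, mul_comm 2 δ]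
    refine mul_le_mul_of_nonneg_left ((div_le_iff₀ (by positivity)).2 ?_) hδ.le
    linarith
  have h5 : matOpNorm (M x) * ‖q‖ ≤ (matOpNorm (M 0) + 2 * L) * δ := by
    have e := matOpNorm_le_add_of_lipschitz hM x 0
    rw [sub_zero] at e
    have e1 := mul_le_mul_of_nonneg_right e (norm_nonneg q)
    nlinarith
  have h6 : matOpNorm (M x) * ‖q‖ * (2 * ‖p‖ + ‖q‖) ≤
      (matOpNorm (M 0) + 2 * L) * δ * (2 * P + 1) := by
    have e : 2 * ‖p‖ + ‖q‖ ≤ 2 * P + 1 := by linarith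
    gcongr
  have h7 : σ / T ^ 2 ≤ σ / (T - t) ^ 2 := by
    have := sub_pos.2 ht.2
    have := ht.1
    gcongr
    linarith
  have h8 : 0 ≤ σ / (T - s) ^ 2 := by positivity
  nlinarith

end Doubling

section Comparison

variable {N : ℕ} {M : EuclideanSpace ℝ (Fin N) → Matrix (Fin N) (Fin N) ℝ}
  {g : EuclideanSpace ℝ (Fin N) → ℝ} {L T : ℝ} {u v : EuclideanSpace ℝ (Fin N) → ℝ → ℝ}

theorem log_one_add_norm_sq_nonneg (x : EuclideanSpace ℝ (Fin N)) :
    0 ≤ Real.log (1 + ‖x‖ ^ 2) :=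
  Real.log_nonneg (by nlinarith [sq_nonneg ‖x‖])

theorem norm_le_exp_of_log_one_add_norm_sq_le {x : EuclideanSpace ℝ (Fin N)} {c : ℝ} (hc : 0 ≤ c)
    (h : Real.log (1 + ‖x‖ ^ 2) ≤ c) : ‖x‖ ≤ Real.exp c := by
  have h1 := (Real.log_le_iff_le_exp (by positivity)).1 h
  have h2 := Real.one_le_exp hc
  nlinarith [norm_nonneg x]

theorem continuousOn_doublingPenalty (hL : 0 < L) {ε δ σ : ℝ} (hε : 0 < ε) :
    ContinuousOn (doublingPenalty (N := N) L T ε δ σ)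
      ((univ ×ˢ Ico 0 T) ×ˢ (univ ×ˢ Ico 0 T)) := by
  have h1 : ∀ q ∈ ((univ : Set (EuclideanSpace ℝ (Fin N))) ×ˢ Ico 0 T) ×ˢ
      ((univ : Set (EuclideanSpace ℝ (Fin N))) ×ˢ Ico 0 T), T - q.1.2 ≠ 0 :=
    fun q hq => (sub_pos.2 hq.1.2.2).ne'
  have h2 : ∀ q ∈ ((univ : Set (EuclideanSpace ℝ (Fin N))) ×ˢ Ico 0 T) ×ˢ
      ((univ : Set (EuclideanSpace ℝ (Fin N))) ×ˢ Ico 0 T), T - q.2.2 ≠ 0 :=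
    fun q hq => (sub_pos.2 hq.2.2.2).ne'
  have hs : Continuous (smoothNorm ε : EuclideanSpace ℝ (Fin N) → ℝ) :=
    (contDiff_smoothNorm hε).continuous
  have hl : Continuous (fun x : EuclideanSpace ℝ (Fin N) => Real.log (1 + ‖x‖ ^ 2)) :=
    contDiff_log_one_add_norm_sq.continuous
  refine ((ContinuousOn.mul ?_ ?_).add (ContinuousOn.mul ?_ ?_)).add
    ((ContinuousOn.div ?_ ?_ h1).add (ContinuousOn.div ?_ ?_ h2))
  · exact continuousOn_const.div (by fun_prop) fun q hq => mul_ne_zero hL.ne' (h1 q hq)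
  · exact (hs.comp (by fun_prop :
      Continuous fun q : (EuclideanSpace ℝ (Fin N) × ℝ) × (EuclideanSpace ℝ (Fin N) × ℝ) =>
        q.1.1 - q.2.1)).continuousOn
  · exact continuousOn_const
  · exact (hl.comp (by fun_prop :
      Continuous fun q : (EuclideanSpace ℝ (Fin N) × ℝ) × (EuclideanSpace ℝ (Fin N) × ℝ) =>
        q.1.1)).continuousOn
  all_goals fun_prop

theorem exists_pos_le_of_linear_error {a c b s : ℝ} (hb : 0 < b) (hs : 0 < s) :
    ∃ δ : ℝ, 0 < δ ∧ δ ≤ 1 ∧ δ * a < b ∧ δ * c < s := by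
  have h : ∀ m : ℝ, Filter.Tendsto (fun δ : ℝ => δ * m) (𝓝[>] 0) (𝓝 0) := fun m => by
    have : ContinuousAt (fun δ : ℝ => δ * m) 0 := by fun_prop
    simpa [ContinuousAt] using this.tendsto.mono_left nhdsWithin_le_nhds
  have h1 : ∀ᶠ δ : ℝ in 𝓝[>] 0, δ ∈ Ioc (0 : ℝ) 1 := Ioc_mem_nhdsGT one_pos
  obtain ⟨δ, h2, h3, h4⟩ :=
    (h1.and (((h a).eventually_lt_const hb).and ((h c).eventually_lt_const hs))).exists
  exact ⟨δ, h2.1, h2.2, h3, h4⟩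

/-- The central estimate: since `K(t)|x - y|` is a supersolution of the doubled equation, it bounds
`u(x,t) - v(y,t)` for every subsolution `u` and supersolution `v` as soon as it does at `t = 0`. -/
theorem IsViscositySubsolution.sub_le_lipBound_mul_norm (hL : 0 < L)
    (hM : ∀ x y, matOpNorm (M x - M y) ≤ L * ‖x - y‖)
    (hg : ∀ x y, g x - g y ≤ lipBound L T 0 * ‖x - y‖)
    (hu : IsViscositySubsolution M g T u) (hv : IsViscositySupersolution M g T v)
    (x y : EuclideanSpace ℝ (Fin N)) {t : ℝ} (ht : t ∈ Ico 0 T) :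
    u x t - v y t ≤ lipBound L T t * ‖x - y‖ := by
  by_contra! hcon
  have hT : 0 < T := ht.1.trans_lt ht.2
  obtain ⟨Bu, hBu⟩ := hu.bounded
  obtain ⟨Bv, hBv⟩ := hv.bounded
  obtain ⟨b, hb, hub⟩ : ∃ b : ℝ, 0 < b ∧ ∀ x y, ∀ t ∈ Ico 0 T, ∀ s ∈ Ico 0 T,
      u x t - v y s ≤ b := by
    refine ⟨|Bu| + |Bv| + 1, by positivity, fun x y t ht s hs => ?_⟩
    have h1 := (abs_le.1 (hBu x t ht)).2
    have h2 := (abs_le.1 (hBv y s hs)).1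
    linarith [le_abs_self Bu, le_abs_self Bv]
  set G := u x t - v y t - lipBound L T t * ‖x - y‖ with hG
  have hG0 : 0 < G := by linarith
  have hK := lipBound_pos hL ht.2
  have hK0 := lipBound_pos hL hT
  have htT := sub_pos.2 ht.2
  -- `ε`, `σ` and `δ` are chosen so that the penalty at `(x, t, y, t)` eats up less than the gap `G`.
  obtain ⟨ε, hε, hεG⟩ : ∃ ε : ℝ, 0 < ε ∧ lipBound L T t * ε = G / 4 :=
    ⟨G / 4 / lipBound L T t, by positivity, by field_simp⟩
  obtain ⟨σ, hσ, hσG⟩ : ∃ σ : ℝ, 0 < σ ∧ σ / (T - t) = G / 8 :=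
    ⟨G / 8 * (T - t), by positivity, by field_simp⟩
  set T₁ := T - σ / b with hT₁
  have hT₁T : T₁ < T := by
    have : 0 < σ / b := by positivity
    linarith
  set P := lipBound L T T₁ with hP
  obtain ⟨δ, hδ, hδ1, hδG, hδσ⟩ := exists_pos_le_of_linear_error
    (a := Real.log (1 + ‖x‖ ^ 2)) (c := 1 / 2 * ((matOpNorm (M 0) + 2 * L) * (2 * P + 1)))
    (b := G / 4) (s := σ / T ^ 2) (by positivity) (by positivity)
  set F : (EuclideanSpace ℝ (Fin N) × ℝ) × (EuclideanSpace ℝ (Fin N) × ℝ) → ℝ := fun q =>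
    u q.1.1 q.1.2 + -v q.2.1 q.2.2 + -doublingPenalty L T ε δ σ q with hF
  set S : Set ((EuclideanSpace ℝ (Fin N) × ℝ) × (EuclideanSpace ℝ (Fin N) × ℝ)) :=
    (Metric.closedBall 0 (Real.exp (b / δ)) ×ˢ Icc 0 T₁) ×ˢ
      (Metric.closedBall 0 (Real.exp (b / δ) + b / lipBound L T 0) ×ˢ Icc 0 T₁) with hS
  set D : Set ((EuclideanSpace ℝ (Fin N) × ℝ) × (EuclideanSpace ℝ (Fin N) × ℝ)) :=
    {q | q.1.2 = 0} ∪ {q | q.2.2 = 0} with hD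
  have hsub : S ⊆ (univ ×ˢ Ico 0 T) ×ˢ (univ ×ˢ Ico 0 T) := fun q hq =>
    ⟨⟨mem_univ _, hq.1.2.1, hq.1.2.2.trans_lt hT₁T⟩,
      ⟨mem_univ _, hq.2.2.1, hq.2.2.2.trans_lt hT₁T⟩⟩
  -- The summands of the penalty are nonnegative.
  have hpen : ∀ q ∈ ((univ : Set (EuclideanSpace ℝ (Fin N))) ×ˢ Ico 0 T) ×ˢ
      ((univ : Set (EuclideanSpace ℝ (Fin N))) ×ˢ Ico 0 T),
      lipBound L T 0 * ‖q.1.1 - q.2.1‖ ≤ lipBound L T q.1.2 * smoothNorm ε (q.1.1 - q.2.1) ∧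
      0 ≤ δ * Real.log (1 + ‖q.1.1‖ ^ 2) ∧ 0 ≤ σ / (T - q.1.2) ∧ 0 ≤ σ / (T - q.2.2) := by
    intro q hq
    have e1 := sub_pos.2 hq.1.2.2
    have e2 := sub_pos.2 hq.2.2.2
    exact ⟨mul_le_mul (lipBound_mono hL hq.1.2.1 hq.1.2.2) (norm_le_smoothNorm _ _)
      (norm_nonneg _) (lipBound_pos hL hq.1.2.2).le,
      mul_nonneg hδ.le (log_one_add_norm_sq_nonneg _), by positivity, by positivity⟩
  have hFS : ∀ q ∈ ((univ : Set (EuclideanSpace ℝ (Fin N))) ×ˢ Ico 0 T) ×ˢ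
      ((univ : Set (EuclideanSpace ℝ (Fin N))) ×ˢ Ico 0 T), 0 < F q → q ∈ S := by
    intro q hq hFq
    obtain ⟨e1, e2, e3, e4⟩ := hpen q hq
    have e0 := hub q.1.1 q.2.1 q.1.2 hq.1.2 q.2.2 hq.2.2
    have e5 : 0 ≤ lipBound L T 0 * ‖q.1.1 - q.2.1‖ := by positivity
    simp only [hF, doublingPenalty] at hFq
    have htime : ∀ r ∈ Ico 0 T, σ / (T - r) ≤ b → r ∈ Icc 0 T₁ := fun r hr h => by
      have := (div_le_iff₀ (sub_pos.2 hr.2)).1 h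
      have h' : σ / b ≤ T - r := (div_le_iff₀ hb).2 (by linarith)
      exact ⟨hr.1, by linarith⟩
    have hx : ‖q.1.1‖ ≤ Real.exp (b / δ) :=
      norm_le_exp_of_log_one_add_norm_sq_le (by positivity)
        ((le_div_iff₀ hδ).2 (by linarith))
    have hxy : ‖q.1.1 - q.2.1‖ ≤ b / lipBound L T 0 := (le_div_iff₀ hK0).2 (by linarith)
    refine ⟨⟨mem_closedBall_zero_iff.2 hx, htime _ hq.1.2 (by linarith)⟩,
      mem_closedBall_zero_iff.2 ?_, htime _ hq.2.2 (by linarith)⟩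
    have := norm_sub_norm_le q.2.1 q.1.1
    rw [norm_sub_rev] at this
    linarith
  have hF0 : 0 < F ((x, t), (y, t)) := by
    have e := mul_le_mul_of_nonneg_left (smoothNorm_le_norm_add hε.le (x - y)) hK.le
    simp only [hF, doublingPenalty, hσG]
    linarith
  have hcompact : IsCompact S :=
    ((isCompact_closedBall _ _).prod isCompact_Icc).prod
      ((isCompact_closedBall _ _).prod isCompact_Icc)
  have hDc : IsClosed D :=
    (isClosed_eq (by fun_prop) (by fun_prop)).union (isClosed_eq (by fun_prop) (by fun_prop))
  have hFusc : UpperSemicontinuousOn F S := by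
    have e1 : UpperSemicontinuousOn
        (fun q : (EuclideanSpace ℝ (Fin N) × ℝ) × (EuclideanSpace ℝ (Fin N) × ℝ) =>
          u q.1.1 q.1.2) S :=
      hu.usc.comp continuous_fst.continuousOn fun q hq => (hsub hq).1
    have e2 : UpperSemicontinuousOn
        (fun q : (EuclideanSpace ℝ (Fin N) × ℝ) × (EuclideanSpace ℝ (Fin N) × ℝ) =>
          -v q.2.1 q.2.2) S :=
      hv.lsc.neg.comp continuous_snd.continuousOn fun q hq => (hsub hq).2
    exact (e1.add e2).add ((continuousOn_doublingPenalty hL hε).mono hsub).neg.upperSemicontinuousOn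
  have hFb : ∀ q ∈ S, F q ≤ b := by
    intro q hq
    obtain ⟨e1, e2, e3, e4⟩ := hpen q (hsub hq)
    have e0 := hub q.1.1 q.2.1 q.1.2 (hsub hq).1.2 q.2.2 (hsub hq).2.2
    have e5 : 0 ≤ lipBound L T 0 * ‖q.1.1 - q.2.1‖ := by positivity
    simp only [hF, doublingPenalty]
    linarith
  -- On the diagonal of `D` both times vanish, and the initial data are ordered.
  have hFD : ∀ q ∈ S ∩ D, (q.1.2 - q.2.2) ^ 2 = 0 → F q ≤ 0 := by
    rintro ⟨⟨x', t'⟩, y', s'⟩ ⟨hq, hqD⟩ hd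
    obtain ⟨e1, e2, e3, e4⟩ := hpen _ (hsub hq)
    have hts : t' = s' := sub_eq_zero.1 (pow_eq_zero_iff two_ne_zero |>.1 hd)
    have ht0 : t' = 0 := by
      rcases hqD with h | h
      · exact h
      · exact hts.trans h
    subst hts
    subst ht0
    simp only [hF, doublingPenalty] at *
    linarith [hg x' y', hu.initial x', hv.initial y']
  obtain ⟨κ, hκ, q, hqS, hqD, hq0, hqmax⟩ := exists_isMaxOn_sub_penalty_notMem hcompact hDc
    (F := F) (d := fun q => (q.1.2 - q.2.2) ^ 2) (b := b) (x₀ := ((x, t), (y, t))) hFusc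
    (by fun_prop) (fun _ => sq_nonneg _) hFb hFD
    (hFS _ ⟨⟨mem_univ _, ht⟩, mem_univ _, ht⟩ hF0) (by simp) hF0
  simp only [hD, mem_union, mem_ofPred_eq, not_or] at hqD
  have hqI := hsub hqS
  have hmem : ∀ x' y', ∀ t' ∈ Ioo 0 T, ∀ s' ∈ Ioo 0 T,
      F ((x', t'), (y', s')) - κ * (t' - s') ^ 2 ≤ F q - κ * (q.1.2 - q.2.2) ^ 2 := by
    intro x' y' t' ht' s' hs'
    by_cases h : ((x', t'), (y', s')) ∈ S
    · exact hqmax _ h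
    · have := not_lt.1 fun h' => h (hFS ((x', t'), (y', s'))
        ⟨⟨mem_univ _, ht'.1.le, ht'.2⟩, mem_univ _, hs'.1.le, hs'.2⟩ h')
      have := mul_nonneg hκ (sq_nonneg (t' - s'))
      linarith
  refine not_isMax_doubling (u := u) (v := v) (x := q.1.1) (y := q.2.1) (t := q.1.2) (s := q.2.2)
    (κ := κ) (P := P) hL hM hu hv hε hδ hδ1 hσ
    ⟨lt_of_le_of_ne hqI.1.2.1 (Ne.symm hqD.1), hqI.1.2.2⟩
    ⟨lt_of_le_of_ne hqI.2.2.1 (Ne.symm hqD.2), hqI.2.2.2⟩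
    (lipBound_mono hL hqS.1.2.2 hT₁T) (by linarith) fun x' y' t' ht' s' hs' => ?_
  have := hmem x' y' t' ht' s' hs'
  simp only [hF] at this
  linarith

end Comparison

/-! ### Regularity in time -/

section TimeRegularity

variable {N : ℕ} {M : EuclideanSpace ℝ (Fin N) → Matrix (Fin N) (Fin N) ℝ}
  {g : EuclideanSpace ℝ (Fin N) → ℝ} {T : ℝ} {u v : EuclideanSpace ℝ (Fin N) → ℝ → ℝ}

/-- Changing the sign of the unknown turns supersolutions into subsolutions for `-M` and `-g`. -/
theorem IsViscositySupersolution.neg (hv : IsViscositySupersolution M g T v) :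
    IsViscositySubsolution (fun x => -M x) (fun x => -g x) T (fun x t => -v x t) where
  bounded := hv.bounded.imp fun B hB x t ht => by simpa using hB x t ht
  usc := hv.lsc.neg
  initial x := neg_le_neg (hv.initial x)
  test φ hφ y t ht hmax := by
    have h := hv.test (fun x s => -φ x s) hφ.neg y t ht (by
      filter_upwards [hmax] with p hp
      linarith)
    have hg : gradient (fun x => -φ x t) y = -gradient (fun x => φ x t) y := by
      have : fderiv ℝ (fun x => -φ x t) y = -fderiv ℝ (fun x => φ x t) y := fderiv_fun_neg
      simp only [gradient, this, map_neg]
    have hd : deriv (fun s => -φ y s) t = -deriv (fun s => φ y s) t := deriv.fun_neg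
    simp only [hjOperator, hg, hd, map_neg, inner_neg_left, inner_neg_right, neg_neg,
      neg_apply] at h ⊢
    linarith

/-- A forward estimate with two auxiliary parameters: `a` confines the maximum of `u - φ` to the
unit ball about `x₀`, and the power `n` keeps it away from the final time `τ₂`. -/
theorem IsViscositySubsolution.time_increment_le_aux (hu : IsViscositySubsolution M g T u)
    {x₀ : EuclideanSpace ℝ (Fin N)} {m K B τ₂ s t a A : ℝ} {n : ℕ}
    (hB : ∀ x, ∀ t ∈ Ico 0 T, |u x t| ≤ B) (hτ₂ : τ₂ ∈ Ioo 0 T)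
    (hm : ∀ x, ‖x - x₀‖ ≤ 1 → matOpNorm (M x) ≤ m)
    (hK : ∀ x, ∀ t ∈ Icc 0 τ₂, |u x t - u x₀ t| ≤ K * ‖x - x₀‖)
    (hK0 : 0 < K) (ha : K < a) (hA : 2 * m * K ^ 2 < A) (hs : 0 ≤ s) (hst : s ≤ t) (ht : t ≤ τ₂) :
    u x₀ t ≤ u x₀ s + K ^ 2 / (4 * a) + A * (t - s) + 2 * B * (t / τ₂) ^ n := by
  by_contra! hcon
  have hτ0 := hτ₂.1
  have ha0 : 0 < a := hK0.trans ha
  have hm0 : 0 ≤ m := (matOpNorm_nonneg _).trans (hm x₀ (by simp))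
  have hB0 : 0 ≤ B := (abs_nonneg _).trans (hB x₀ 0 ⟨le_rfl, hτ₂.1.trans hτ₂.2⟩)
  have hA0 : 0 < A := lt_of_le_of_lt (by positivity) hA
  have hIco : ∀ r ∈ Icc s τ₂, r ∈ Ico 0 T := fun r hr =>
    ⟨hs.trans hr.1, hr.2.trans_lt hτ₂.2⟩
  set φ : EuclideanSpace ℝ (Fin N) → ℝ → ℝ := fun z r =>
    a * ‖z - x₀‖ ^ 2 + (u x₀ s + K ^ 2 / (4 * a) + (A * (r - s) + 2 * B * (r / τ₂) ^ n)) with hφ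
  have hφs : ContDiff ℝ 1 (Function.uncurry φ) := by
    have e1 : ContDiff ℝ 1 (fun w : EuclideanSpace ℝ (Fin N) × ℝ => ‖w.1 - x₀‖ ^ 2) :=
      (contDiff_norm_sq ℝ).comp (contDiff_fst.sub contDiff_const)
    exact (contDiff_const.mul e1).add (contDiff_const.add
      ((contDiff_const.mul (contDiff_snd.sub contDiff_const)).add
        (contDiff_const.mul ((contDiff_snd.div_const _).pow n))))
  set S : Set (EuclideanSpace ℝ (Fin N) × ℝ) := Metric.closedBall x₀ 1 ×ˢ Icc s τ₂ with hS
  have husc : UpperSemicontinuousOn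
      (fun w : EuclideanSpace ℝ (Fin N) × ℝ => u w.1 w.2 + -φ w.1 w.2) S := by
    have e1 : UpperSemicontinuousOn
        (fun w : EuclideanSpace ℝ (Fin N) × ℝ => u w.1 w.2) S :=
      hu.usc.mono fun w hw => ⟨mem_univ _, hIco _ hw.2⟩
    exact e1.add hφs.continuous.neg.continuousOn.upperSemicontinuousOn
  have hx₀S : (x₀, t) ∈ S := ⟨by simp, hst, ht⟩
  obtain ⟨⟨x, r⟩, hxr, hmax⟩ := husc.exists_isMaxOn ⟨_, hx₀S⟩
    ((isCompact_closedBall _ _).prod isCompact_Icc)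
  have hmax' : ∀ z, ‖z - x₀‖ ≤ 1 → ∀ r' ∈ Icc s τ₂, u z r' - φ z r' ≤ u x r - φ x r := by
    intro z hz r' hr'
    have : u z r' + -φ z r' ≤ u x r + -φ x r :=
      hmax (show (z, r') ∈ S from ⟨mem_closedBall_iff_norm.2 hz, hr'⟩)
    linarith
  have hx1 : ‖x - x₀‖ ≤ 1 := mem_closedBall_iff_norm.1 hxr.1
  have hrI : r ∈ Icc s τ₂ := hxr.2
  have hpos : 0 < u x r - φ x r := by
    refine lt_of_lt_of_le ?_ (hmax' x₀ (by simp) t ⟨hst, ht⟩)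
    simp only [hφ, sub_self, norm_zero]
    linarith
  have hpow : ∀ r' ∈ Icc s τ₂, 0 ≤ 2 * B * (r' / τ₂) ^ n := fun r' hr' => by
    have := hs.trans hr'.1
    positivity
  have hR := norm_nonneg (x - x₀)
  have hux := (abs_le.1 (hK x r ⟨hs.trans hrI.1, hrI.2⟩)).2
  -- Comparison with the value at `x₀` bounds the gradient `2 a (x - x₀)` at the maximum.
  have haR : a * ‖x - x₀‖ ≤ K := by
    have h1 := hmax' x₀ (by simp) r hrI
    simp only [hφ, sub_self, norm_zero] at h1
    rcases hR.eq_or_lt with h0 | h0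
    · rw [← h0, mul_zero]
      exact hK0.le
    · refine le_of_mul_le_mul_right ?_ h0
      nlinarith
  have hR1 : ‖x - x₀‖ < 1 := by
    by_contra! h
    nlinarith
  have hrs : s < r := by
    refine lt_of_le_of_ne hrI.1 fun h => ?_
    subst h
    have h2 := hpow s hrI
    have h3 : K * ‖x - x₀‖ ≤ a * ‖x - x₀‖ ^ 2 + K ^ 2 / (4 * a) := by
      have e : a * ‖x - x₀‖ ^ 2 + K ^ 2 / (4 * a) - K * ‖x - x₀‖ =
          (2 * a * ‖x - x₀‖ - K) ^ 2 / (4 * a) := by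
        field_simp
        ring
      have : 0 ≤ (2 * a * ‖x - x₀‖ - K) ^ 2 / (4 * a) := by positivity
      linarith
    simp only [hφ, sub_self, mul_zero] at hpos
    linarith
  have hrτ : r < τ₂ := by
    refine lt_of_le_of_ne hrI.2 fun h => ?_
    subst h
    have h1 := (abs_le.1 (hB x r (hIco r hrI))).2
    have h2 := (abs_le.1 (hB x₀ s (hIco s ⟨le_rfl, hrI.1⟩))).1
    have h3 : 0 ≤ A * (r - s) := mul_nonneg hA0.le (sub_nonneg.2 hrI.1)
    have h4 : 0 ≤ a * ‖x - x₀‖ ^ 2 := by positivity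
    have h5 : 0 ≤ K ^ 2 / (4 * a) := by positivity
    simp only [hφ, div_self hτ0.ne', one_pow, mul_one] at hpos
    linarith
  have hr0 : 0 < r := hs.trans_lt hrs
  have htest := hu.test φ hφs.contDiffOn x r ⟨hr0, hrτ.trans hτ₂.2⟩ (by
    have e1 : ∀ᶠ w : EuclideanSpace ℝ (Fin N) × ℝ in 𝓝 (x, r), w.2 ∈ Ioo s τ₂ :=
      continuous_snd.continuousAt.eventually_mem (Ioo_mem_nhds hrs hrτ)
    have e2 : ∀ᶠ w : EuclideanSpace ℝ (Fin N) × ℝ in 𝓝 (x, r), w.1 ∈ Metric.ball x₀ 1 :=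
      continuous_fst.continuousAt.eventually_mem
        (Metric.isOpen_ball.mem_nhds (mem_ball_iff_norm.2 hR1))
    filter_upwards [e1, e2] with w hw1 hw2
    exact hmax' w.1 (mem_ball_iff_norm.1 hw2).le w.2 (Ioo_subset_Icc_self hw1))
  have hd : HasDerivAt (fun r => φ x r)
      (A * 1 + 2 * B * (n * (r / τ₂) ^ (n - 1) * (1 / τ₂))) r :=
    (((((hasDerivAt_id r).sub_const s).const_mul A).add
      ((((hasDerivAt_id r).div_const τ₂).pow n).const_mul (2 * B))).const_add _).const_add _
  have hgr : HasGradientAt (fun z => φ z r) (a • (2 : ℝ) • (x - x₀)) x := by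
    have e := (((hasDerivAt_id _).const_mul a).comp_hasGradientAt_real
      (hasGradientAt_norm_sub_sq x₀ x)).add_real (hasGradientAt_const x
        (u x₀ s + K ^ 2 / (4 * a) + (A * (r - s) + 2 * B * (r / τ₂) ^ n)))
    simpa only [mul_one, add_zero, id] using e
  rw [hjOperator_eq_add_hamiltonian M hd hgr] at htest
  have h1 := (abs_le.1 (abs_hamiltonian_le (M x) (a • (2 : ℝ) • (x - x₀)))).1
  have h2 : ‖a • (2 : ℝ) • (x - x₀)‖ ≤ 2 * K := by
    rw [norm_smul, norm_smul, Real.norm_of_nonneg ha0.le, Real.norm_two]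
    linarith
  have h3 : matOpNorm (M x) * ‖a • (2 : ℝ) • (x - x₀)‖ ^ 2 ≤ m * (2 * K) ^ 2 := by
    have := hm x hx1
    gcongr
  have h4 : 0 ≤ 2 * B * (n * (r / τ₂) ^ (n - 1) * (1 / τ₂)) := by positivity
  nlinarith

theorem IsViscositySubsolution.time_increment_le (hu : IsViscositySubsolution M g T u)
    {x₀ : EuclideanSpace ℝ (Fin N)} {m K τ₂ s t : ℝ} (hτ₂ : τ₂ ∈ Ioo 0 T)
    (hm : ∀ x, ‖x - x₀‖ ≤ 1 → matOpNorm (M x) ≤ m)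
    (hK : ∀ x, ∀ t ∈ Icc 0 τ₂, |u x t - u x₀ t| ≤ K * ‖x - x₀‖)
    (hK0 : 0 < K) (hs : 0 ≤ s) (hst : s ≤ t) (ht : t < τ₂) :
    u x₀ t - u x₀ s ≤ 2 * m * K ^ 2 * (t - s) := by
  obtain ⟨B, hB⟩ := hu.bounded
  have haux : ∀ k : ℕ, u x₀ t ≤ u x₀ s + K ^ 2 / (4 * (K + 1 + k)) +
      (2 * m * K ^ 2 + 1 / ((k : ℝ) + 1)) * (t - s) + 2 * B * (t / τ₂) ^ k := fun k =>
    hu.time_increment_le_aux hB hτ₂ hm hK hK0 (by have := k.cast_nonneg (α := ℝ); linarith)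
      (by have : 0 < 1 / ((k : ℝ) + 1) := by positivity
          linarith) hs hst ht.le
  have l1 : Filter.Tendsto (fun k : ℕ => K ^ 2 / (4 * (K + 1 + k))) Filter.atTop (𝓝 0) :=
    tendsto_const_nhds.div_atTop ((Filter.tendsto_atTop_add_const_left _ _
      tendsto_natCast_atTop_atTop).const_mul_atTop (by norm_num))
  have l2 : Filter.Tendsto (fun k : ℕ => (t / τ₂) ^ k) Filter.atTop (𝓝 0) :=
    tendsto_pow_atTop_nhds_zero_of_lt_one (div_nonneg (hs.trans hst) hτ₂.1.le)
      ((div_lt_one hτ₂.1).2 ht)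
  have l3 := ((l1.const_add (u x₀ s)).add
    ((tendsto_one_div_add_atTop_nhds_zero_nat.const_add (2 * m * K ^ 2)).mul_const
      (t - s))).add (l2.const_mul (2 * B))
  have := ge_of_tendsto' l3 haux
  linarith

/-- A viscosity solution that is `K`-Lipschitz in space is `2 m K²`-Lipschitz in time at `x₀`, where
`m` bounds `M` near `x₀`. -/
theorem IsViscositySolution.abs_time_increment_le (hu : IsViscositySolution M g T u)
    {x₀ : EuclideanSpace ℝ (Fin N)} {m K τ₂ s t : ℝ} (hτ₂ : τ₂ ∈ Ioo 0 T)
    (hm : ∀ x, ‖x - x₀‖ ≤ 1 → matOpNorm (M x) ≤ m)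
    (hK : ∀ x, ∀ t ∈ Icc 0 τ₂, |u x t - u x₀ t| ≤ K * ‖x - x₀‖)
    (hK0 : 0 < K) (hs : s ∈ Ico 0 τ₂) (ht : t ∈ Ico 0 τ₂) :
    |u x₀ t - u x₀ s| ≤ 2 * m * K ^ 2 * |t - s| := by
  wlog hst : s ≤ t generalizing s t
  · rw [abs_sub_comm, abs_sub_comm t]
    exact this ht hs (le_of_not_ge hst)
  have h1 := hu.1.time_increment_le hτ₂ hm hK hK0 hs.1 hst ht.2
  have h2 := hu.2.neg.time_increment_le hτ₂
    (fun x hx => (matOpNorm_neg (M x)).trans_le (hm x hx))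
    (fun x t ht => by
      rw [neg_sub_neg, abs_sub_comm]
      exact hK x t ht) hK0 hs.1 hst ht.2
  rw [abs_of_nonneg (sub_nonneg.2 hst), abs_le]
  constructor <;> linarith

end TimeRegularity

/-! ### Comparison and regularity -/

theorem mainTheorem4 (N : ℕ)
    (M : EuclideanSpace ℝ (Fin N) → Matrix (Fin N) (Fin N) ℝ)
    (g : EuclideanSpace ℝ (Fin N) → ℝ) (L C T : ℝ) (hL : 0 < L) (hC : 0 < C)
    (hM : ∀ x y, matOpNorm (M x - M y) ≤ L * ‖x - y‖)
    (hgb : ∃ B : ℝ, ∀ x, |g x| ≤ B)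
    (hg : ∀ x y, |g x - g y| ≤ C * ‖x - y‖)
    (hT : T = 2 / (L * C)) :
    -- comparison
    (∀ u v : EuclideanSpace ℝ (Fin N) → ℝ → ℝ,
      IsViscositySubsolution M g T u → IsViscositySupersolution M g T v →
        ∀ x, ∀ t ∈ Ico 0 T, u x t ≤ v x t) ∧
    -- uniqueness
    (∀ u v : EuclideanSpace ℝ (Fin N) → ℝ → ℝ,
      IsViscositySolution M g T u → IsViscositySolution M g T v →
        ∀ x, ∀ t ∈ Ico 0 T, u x t = v x t) ∧
    -- regularity
    (∀ u : EuclideanSpace ℝ (Fin N) → ℝ → ℝ, IsViscositySolution M g T u →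
      (∀ τ ∈ Ioo 0 T,
        (∃ K : ℝ, 0 < K ∧ ∀ x y, ∀ t ∈ Icc 0 τ, |u x t - u y t| ≤ K * ‖x - y‖) ∧
        (∀ R : ℝ, 0 < R → ∃ K : ℝ, 0 < K ∧
          ∀ x, ‖x‖ < R → ∀ t ∈ Icc 0 τ, ∀ s ∈ Icc 0 τ,
            |u x t - u x s| ≤ K * |t - s|)) ∧
      ((∃ B : ℝ, ∀ x, matOpNorm (M x) ≤ B) →
        ∀ τ ∈ Ioo 0 T, ∃ K : ℝ, 0 < K ∧
          ∀ x y, ∀ t ∈ Icc 0 τ, ∀ s ∈ Icc 0 τ,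
            |u x t - u y s| ≤ K * (‖x - y‖ + |t - s|))) := by
  have hT0 : 0 < T := by
    rw [hT]
    positivity
  have hK0 : lipBound L T 0 = C := by
    rw [lipBound, hT]
    field_simp
    ring
  have hg' : ∀ x y, g x - g y ≤ lipBound L T 0 * ‖x - y‖ := fun x y => by
    rw [hK0]
    exact (le_abs_self _).trans (hg x y)
  have hcomp : ∀ u v : EuclideanSpace ℝ (Fin N) → ℝ → ℝ,
      IsViscositySubsolution M g T u → IsViscositySupersolution M g T v →
        ∀ x, ∀ t ∈ Ico 0 T, u x t ≤ v x t := fun u v hu hv x t ht => by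
    simpa using hu.sub_le_lipBound_mul_norm hL hM hg' hv x x ht
  have hspace : ∀ u : EuclideanSpace ℝ (Fin N) → ℝ → ℝ, IsViscositySolution M g T u →
      ∀ τ ∈ Ioo 0 T, ∀ x y, ∀ t ∈ Icc 0 τ, |u x t - u y t| ≤ lipBound L T τ * ‖x - y‖ := by
    intro u hu τ hτ x y t ht
    have htT : t ∈ Ico 0 T := ⟨ht.1, ht.2.trans_lt hτ.2⟩
    have h1 := hu.1.sub_le_lipBound_mul_norm hL hM hg' hu.2 x y htT
    have h2 := hu.1.sub_le_lipBound_mul_norm hL hM hg' hu.2 y x htT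
    rw [norm_sub_rev] at h2
    have h3 := mul_le_mul_of_nonneg_right (lipBound_mono hL ht.2 hτ.2) (norm_nonneg (x - y))
    rw [abs_le]
    constructor <;> linarith
  -- Regularity in time up to `τ` uses the spatial Lipschitz constant at the later time `τ₂`.
  have htime : ∀ u : EuclideanSpace ℝ (Fin N) → ℝ → ℝ, IsViscositySolution M g T u →
      ∀ τ ∈ Ioo 0 T, ∀ m x₀, (∀ x, ‖x - x₀‖ ≤ 1 → matOpNorm (M x) ≤ m) →
        ∀ t ∈ Icc 0 τ, ∀ s ∈ Icc 0 τ,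
          |u x₀ t - u x₀ s| ≤ 2 * m * lipBound L T ((τ + T) / 2) ^ 2 * |t - s| := by
    intro u hu τ hτ m x₀ hm t ht s hs
    have hτ1 := hτ.1
    have hτ2 := hτ.2
    have hτ₂ : (τ + T) / 2 ∈ Ioo 0 T := ⟨by linarith, by linarith⟩
    exact hu.abs_time_increment_le hτ₂ hm (fun x t ht => hspace u hu _ hτ₂ x x₀ t ht)
      (lipBound_pos hL hτ₂.2) ⟨hs.1, by linarith [hs.2]⟩ ⟨ht.1, by linarith [ht.2]⟩
  refine ⟨hcomp, fun u v hu hv x t ht =>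
    (hcomp u v hu.1 hv.2 x t ht).antisymm (hcomp v u hv.1 hu.2 x t ht),
    fun u hu => ⟨fun τ hτ => ⟨⟨_, lipBound_pos hL hτ.2, hspace u hu τ hτ⟩, fun R hR => ?_⟩,
      fun ⟨B, hB⟩ τ hτ => ?_⟩⟩
  · have hm := matOpNorm_nonneg (M 0)
    have hK : 0 < lipBound L T ((τ + T) / 2) := lipBound_pos hL (by linarith [hτ.2])
    refine ⟨2 * (matOpNorm (M 0) + L * (R + 1)) * lipBound L T ((τ + T) / 2) ^ 2, by positivity,
      fun x hx => htime u hu τ hτ _ x fun z hz => ?_⟩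
    have h1 := matOpNorm_le_add_of_lipschitz hM z 0
    have h2 : ‖z‖ ≤ R + 1 := by
      have := norm_sub_norm_le z x
      linarith
    rw [sub_zero] at h1
    nlinarith
  · have hB0 := (matOpNorm_nonneg (M 0)).trans (hB 0)
    have hK := lipBound_pos hL hτ.2
    have hK' : 0 < lipBound L T ((τ + T) / 2) := lipBound_pos hL (by linarith [hτ.2])
    have hpos : 0 ≤ 2 * B * lipBound L T ((τ + T) / 2) ^ 2 := by positivity
    refine ⟨lipBound L T τ + 2 * B * lipBound L T ((τ + T) / 2) ^ 2, by positivity,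
      fun x y t ht s hs => ?_⟩
    have h1 := hspace u hu τ hτ x y t ht
    have h2 := htime u hu τ hτ B y (fun z _ => hB z) t ht s hs
    have h3 := abs_sub_le (u x t) (u y t) (u y s)
    have h4 := mul_nonneg hK.le (abs_nonneg (t - s))
    have h5 := mul_nonneg hpos (norm_nonneg (x - y))
    linarith
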